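/- Consider the network creation game with a finite set $V$ of $n$ agents and edge price $\alpha\in\mathbb{R}$. Each agent $u\in V$ chooses a strategy $S_u\subseteq V\setminus\{u\}$. The strategy vector $\mathbf{s}=(S_u)_{u\in V}$ induces the undirected network $G(\mathbf{s})$ with vertex set $V$ in which $u$ and $v$ are adjacent if and only if $v\in S_u$ or $u\in S_v$. The cost of agent $u$ is $\alpha|S_u|+\sum_{w\in V}d_{G(\mathbf{s})}(u,w)$ if $G(\mathbf{s})$ is connected, where $d_{G(\mathbf{s})}$ denotes the graph distance, and $\infty$ otherwise. The network is called stable if $\mathbf{s}$ is a pure Nash equilibrium, that is, no agent can strictly decrease her cost by changing only her own strategy. If $n\ge 4$ and $\alpha>4n-13$, then every stable network is a tree. -/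

import Mathlib

namespace NetworkCreation

/-- A (pure) strategy of agent `u`: the set of other agents to whom `u` buys an edge. -/
abbrev Strategy (V : Type*) (u : V) : Type _ := {S : Finset V // u ∉ S}

/-- A strategy vector: one strategy for every agent. -/
abbrev Profile (V : Type*) : Type _ := (u : V) → Strategy V u

/-- The undirected network induced by a strategy vector: `u` and `v` are joined by an edge
iff at least one of them buys it. -/
def network {V : Type*} (s : Profile V) : SimpleGraph V where
  Adj u v := v ∈ (s u).1 ∨ u ∈ (s v).1
  symm := ⟨fun _ _ h => Or.symm h⟩
  loopless := ⟨fun u h => h.elim (s u).2 (s u).2⟩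

open Classical in
/-- The distance cost of `u` in `G`: the sum of the distances from `u` to all vertices if `G` is
connected, and infinite otherwise. -/
noncomputable def distCost {V : Type*} [Fintype V] (G : SimpleGraph V) (u : V) : EReal :=
  if G.Connected then ((∑ w : V, (G.dist u w : ℝ) : ℝ) : EReal) else ⊤

/-- The cost of agent `u`: `α` for every edge that she buys, plus her distance cost. -/
noncomputable def cost {V : Type*} [Fintype V] (α : ℝ) (s : Profile V) (u : V) : EReal :=
  ((α * ((s u).1.card : ℝ) : ℝ) : EReal) + distCost (network s) u

/-- The strategy vector `s` is a pure Nash equilibrium (its network is stable) for edge price `α`: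
no agent can strictly decrease her cost by changing only her own strategy. -/
def IsStable {V : Type*} [Fintype V] [DecidableEq V] (α : ℝ) (s : Profile V) : Prop :=
  ∀ (u : V) (t : Strategy V u), ¬ cost α (Function.update s u t) u < cost α s u

end NetworkCreation

/-!
Let `n` be the number of agents, and suppose that a stable network with `α > 4 n - 13` has an edge
that is not a bridge. A shortest cycle through this edge is *isometric*: distances along the cycle
are distances of the network (`exists_isIsometricCycle`). The proof shows that such a cycle hangs in
the network like a directed cycle with trees attached to it, and that this is not stable.

The main tool is `IsStable.le_of_exchange`. It concerns an agent `v` who owns two edges `v v₁` and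
`v v₂`, and an agent `u` at distance `d ≥ 2` who owns an edge `u u₁`. If none of these edges is
needed in order to see the network from the other agent, then each of `u` and `v` can give up her
edges and buy one to the other agent, which makes her distances at most those of the other agent
plus one. Adding up the equilibrium conditions, the distance costs cancel, and `α ≤ 4 n - 13` is
left.

On an isometric cycle this is applied to a vertex and an (almost) opposite one. Cycles have length
at least `6` (`IsStable.six_le_length`), since otherwise it pays to delete an edge. An agent cannot
own both of her edges on an isometric cycle (`IsStable.not_owns_both`), so every agent on it owns
the edge to her successor (`IsStable.owns_succ`). More generally, an agent cannot own two non-bridge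
edges, as one sees from the longer of the shortest cycles through them (`IsStable.eq_of_owns`).
Therefore only bridges lead away from an isometric cycle (`IsStable.isBridge_of_notMem`), and every
vertex of the network is attached to the cycle `a` at a unique vertex, its gate
(`IsIsometricCycle.exists_isGate`).

Finally, let the agent `a i` replace her edge to `a (i + 1)` by one to `a (i + 2)`. As this is no
improvement, fewer vertices have the gate `a (i + 2)` than `a (i + 1)`
(`IsStable.card_isGate_lt`). Going once around the cycle gives a contradiction.
-/

open NetworkCreation

namespace NetworkCreation

variable {V : Type*}

/-! ### Walks of bounded length -/

/-- `Within G b x y`: some walk of length at most `b` joins `x` to `y` in `G`. Unlike an upper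
bound on `G.dist x y`, this is meaningful (and false) when `x` and `y` are not connected, so that
it can be used for networks that are not yet known to be connected. -/
def Within (G : SimpleGraph V) (b : ℕ) (x y : V) : Prop :=
  ∃ p : G.Walk x y, p.length ≤ b

namespace Within

variable {G H : SimpleGraph V} {b c : ℕ} {x y z : V}

theorem refl (G : SimpleGraph V) (b : ℕ) (x : V) : Within G b x x :=
  ⟨.nil, by simp⟩

theorem of_adj (h : G.Adj x y) : Within G 1 x y :=
  ⟨h.toWalk, by simp⟩

theorem of_dist (h : G.Connected) (x y : V) : Within G (G.dist x y) x y :=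
  let ⟨p, hp⟩ := h.exists_walk_length_eq_dist x y
  ⟨p, hp.le⟩

theorem trans (h₁ : Within G b x y) (h₂ : Within G c y z) : Within G (b + c) x z :=
  let ⟨p, hp⟩ := h₁
  let ⟨q, hq⟩ := h₂
  ⟨p.append q, by rw [SimpleGraph.Walk.length_append]; omega⟩

theorem symm (h : Within G b x y) : Within G b y x :=
  let ⟨p, hp⟩ := h
  ⟨p.reverse, by simpa using hp⟩

theorem mono (h : Within G b x y) (hbc : b ≤ c) : Within G c x y :=
  let ⟨p, hp⟩ := h
  ⟨p, hp.trans hbc⟩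

theorem mono_graph (h : Within G b x y) (hGH : G ≤ H) : Within H b x y :=
  let ⟨p, hp⟩ := h
  ⟨p.mapLe hGH, by simpa using hp⟩

theorem dist_le (h : Within G b x y) : G.dist x y ≤ b :=
  let ⟨p, hp⟩ := h
  (SimpleGraph.dist_le p).trans hp

theorem reachable (h : Within G b x y) : G.Reachable x y :=
  let ⟨p, _⟩ := h
  ⟨p⟩

theorem of_forall_adj (G : SimpleGraph V) {a : ℤ → V} (i : ℤ) (t : ℕ)
    (h : ∀ j : ℕ, j < t → G.Adj (a (i + j)) (a (i + j + 1))) :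
    Within G t (a i) (a (i + t)) := by
  induction t with
  | zero => simpa using Within.refl G 0 (a i)
  | succ t ih =>
    refine (ih fun j hj => h j (by omega)).trans ?_
    rw [Nat.cast_succ, ← add_assoc]
    exact .of_adj (h t (by omega))

end Within

/-- A vertex `w ≠ c` of a connected graph has a neighbour one step closer to `c`. -/
theorem exists_adj_dist_add_one {G : SimpleGraph V} (h : G.Connected) {c w : V} (hw : w ≠ c) :
    ∃ w', G.Adj w' w ∧ G.dist c w = G.dist c w' + 1 := by
  obtain ⟨p, hp⟩ := h.exists_walk_length_eq_dist w c
  cases p with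
  | nil => exact absurd rfl hw
  | @cons _ w' _ hadj q =>
    refine ⟨w', hadj.symm, le_antisymm ?_ ?_⟩
    · calc G.dist c w ≤ G.dist c w' + G.dist w' w := h.dist_triangle
        _ = G.dist c w' + 1 := by rw [SimpleGraph.dist_eq_one_iff_adj.2 hadj.symm]
    · rw [SimpleGraph.dist_comm (u := c) (v := w), ← hp, SimpleGraph.dist_comm,
        SimpleGraph.Walk.length_cons]
      exact Nat.succ_le_succ (SimpleGraph.dist_le q)

/-! ### Deviations of a single agent -/

section Deviation

variable {α : ℝ} {s : Profile V}

theorem cost_of_connected [Fintype V] (h : (network s).Connected) (u : V) :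
    cost α s u = ((α * ((s u).1.card : ℝ) + ∑ w : V, ((network s).dist u w : ℝ) : ℝ) : EReal) := by
  rw [cost, distCost, if_pos h, EReal.coe_add]

theorem cost_of_not_connected [Fintype V] (h : ¬ (network s).Connected) (u : V) : cost α s u = ⊤ := by
  rw [cost, distCost, if_neg h, EReal.coe_add_top]

variable [DecidableEq V]

/-- The network after agent `u` has deleted her edges to `D` and bought edges to `A`.
The vertex `u` is erased from the new strategy, so that no assumption `u ∉ A` is needed. -/
def deviation (s : Profile V) (u : V) (D A : Finset V) : SimpleGraph V :=
  network (Function.update s u ⟨((s u).1 \ D ∪ A).erase u, by simp⟩)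

theorem deviation_adj_of_adj {u : V} {D A : Finset V} {x y : V}
    (h : (network s).Adj x y) :
    (deviation s u D A).Adj x y ∨ (x = u ∧ y ∈ D) ∨ (y = u ∧ x ∈ D) := by
  have hne := h.ne
  have key : ∀ x y : V, x ≠ y → y ∈ (s x).1 →
      y ∈ (Function.update s u ⟨((s u).1 \ D ∪ A).erase u, by simp⟩ x).1 ∨ (x = u ∧ y ∈ D) := by
    intro x y hxy hy
    by_cases hx : x = u
    · subst hx
      by_cases hD : y ∈ D
      · exact .inr ⟨rfl, hD⟩
      · left
        simp [hxy.symm, hy, hD]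
    · left
      rwa [Function.update_of_ne hx]
  rcases h with h | h
  · rcases key x y hne h with h | h
    · exact .inl (.inl h)
    · exact .inr (.inl h)
  · rcases key y x hne.symm h with h | h
    · exact .inl (.inr h)
    · exact .inr (.inr h)

theorem deviation_adj_of_mem {u : V} {D A : Finset V} {y : V} (hy : y ∈ A)
    (hne : y ≠ u) : (deviation s u D A).Adj u y := by
  left
  simp [hne, hy]

theorem deleteEdges_le_deviation {u : V} {D A : Finset V} {E : Set (Sym2 V)}
    (hE : ∀ y ∈ D, s(u, y) ∈ E) : (network s).deleteEdges E ≤ deviation s u D A := by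
  intro x y h
  rw [SimpleGraph.deleteEdges_adj] at h
  rcases deviation_adj_of_adj (u := u) (D := D) (A := A) h.1 with h' | ⟨rfl, hy⟩ | ⟨rfl, hx⟩
  · exact h'
  · exact absurd (hE y hy) h.2
  · exact absurd (Sym2.eq_swap ▸ hE x hx) h.2

variable [Fintype V]

/-- In a disconnected network every agent could buy an edge to everybody else. -/
theorem IsStable.connected [Nonempty V] (hs : IsStable α s) : (network s).Connected := by
  by_contra h
  obtain ⟨u⟩ := ‹Nonempty V›
  refine hs u ⟨Finset.univ.erase u, by simp⟩ ?_
  have hc : (network (Function.update s u ⟨Finset.univ.erase u, by simp⟩)).Connected := by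
    rw [SimpleGraph.connected_iff_exists_forall_reachable]
    refine ⟨u, fun w => ?_⟩
    by_cases hw : w = u
    · rw [hw]
    · refine SimpleGraph.Adj.reachable (.inl ?_)
      simp [hw]
  rw [cost_of_not_connected h, cost_of_connected hc]
  exact EReal.coe_lt_top _

/-- The equilibrium condition for one deviation: it does not help agent `u` to delete her edges to
`D` and to buy edges to `A`, if this makes `w` reachable within `f w` steps for every `w`. -/
theorem IsStable.le_of_within (hs : IsStable α s) (hα : 0 ≤ α) (hc : (network s).Connected)
    {u : V} {D A : Finset V} (hD : D ⊆ (s u).1) {f : V → ℕ}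
    (hf : ∀ w, Within (deviation s u D A) (f w) u w) :
    α * D.card + ∑ w : V, ((network s).dist u w : ℝ) ≤ α * A.card + ∑ w : V, (f w : ℝ) := by
  have hc' : (deviation s u D A).Connected :=
    (SimpleGraph.connected_iff_exists_forall_reachable _).2 ⟨u, fun w => (hf w).reachable⟩
  have h := hs u ⟨((s u).1 \ D ∪ A).erase u, by simp⟩
  rw [cost_of_connected hc, cost_of_connected hc', EReal.coe_lt_coe_iff, not_lt] at h
  have hcard : ((((s u).1 \ D ∪ A).erase u).card : ℝ) + D.card ≤ (s u).1.card + A.card := by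
    have h₁ := Finset.card_erase_le (s := (s u).1 \ D ∪ A) (a := u)
    have h₂ := Finset.card_union_le ((s u).1 \ D) A
    have h₃ := Finset.card_sdiff_add_card_eq_card hD
    exact_mod_cast (by omega :
      (((s u).1 \ D ∪ A).erase u).card + D.card ≤ (s u).1.card + A.card)
  have hdist : ∑ w : V, ((deviation s u D A).dist u w : ℝ) ≤ ∑ w : V, (f w : ℝ) :=
    Finset.sum_le_sum fun w _ => by exact_mod_cast (hf w).dist_le
  have hmul := mul_le_mul_of_nonneg_left hcard hα
  rw [Function.update_self] at h
  change _ ≤ α * ((((s u).1 \ D ∪ A).erase u).card : ℝ)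
    + ∑ w : V, ((deviation s u D A).dist u w : ℝ) at h
  linarith

end Deviation

/-! ### Isometric cycles -/

/-- `IsIsometricCycle G k a`: the vertices `a 0, a 1, …, a (k - 1)` form a cycle of length `k ≥ 3`
in `G` on which the distances of `G` agree with the distances along the cycle. The cycle is
encoded as a `k`-periodic function on `ℤ`, so that it can be rotated and reflected freely. -/
structure IsIsometricCycle (G : SimpleGraph V) (k : ℕ) (a : ℤ → V) : Prop where
  three_le : 3 ≤ k
  periodic : ∀ i, a (i + k) = a i
  dist_eq : ∀ (i : ℤ) (t : ℕ), t ≤ k → G.dist (a i) (a (i + t)) = min t (k - t)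

namespace IsIsometricCycle

variable {G : SimpleGraph V} {k : ℕ} {a : ℤ → V}

theorem rotate (h : IsIsometricCycle G k a) (j : ℤ) :
    IsIsometricCycle G k fun i => a (j + i) where
  three_le := h.three_le
  periodic i := by rw [← add_assoc, h.periodic]
  dist_eq i t ht := by rw [← add_assoc, h.dist_eq _ _ ht]

theorem reflect (h : IsIsometricCycle G k a) : IsIsometricCycle G k fun i => a (-i) where
  three_le := h.three_le
  periodic i := by rw [← h.periodic]; congr 1; ring
  dist_eq i t ht := by
    rw [SimpleGraph.dist_comm, ← h.dist_eq (-(i + t)) t ht]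
    congr 2; ring

theorem ne (h : IsIsometricCycle G k a) (i : ℤ) {t : ℕ} (h0 : 0 < t) (ht : t < k) :
    a i ≠ a (i + t) := by
  intro he
  have := h.dist_eq i t ht.le
  rw [← he, SimpleGraph.dist_self] at this
  omega

theorem adj (h : IsIsometricCycle G k a) (i : ℤ) : G.Adj (a i) (a (i + 1)) := by
  have h3 := h.three_le
  have := h.dist_eq i 1 (by omega)
  rw [Nat.cast_one] at this
  rw [← SimpleGraph.dist_eq_one_iff_adj, this]
  omega

/-- Walking along the cycle while avoiding a vertex `c`, and thus all the edges at `c`. -/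
theorem within_deleteEdges (h : IsIsometricCycle G k a) {E : Set (Sym2 V)} {c : V}
    (hE : ∀ e ∈ E, c ∈ e) (i : ℤ) (t : ℕ) (hc : ∀ j : ℕ, j ≤ t → a (i + j) ≠ c) :
    Within (G.deleteEdges E) t (a i) (a (i + t)) := by
  refine Within.of_forall_adj _ i t fun j hj => ?_
  rw [SimpleGraph.deleteEdges_adj]
  refine ⟨h.adj _, fun he => ?_⟩
  rcases Sym2.mem_iff.1 (hE _ he) with h' | h'
  · exact hc j hj.le h'.symm
  · refine hc (j + 1) hj ?_
    rw [h', Nat.cast_succ, add_assoc]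

theorem reachable_deleteEdges (h : IsIsometricCycle G k a) (i : ℤ) :
    (G.deleteEdges {s(a i, a (i + 1))}).Reachable (a i) (a (i + 1)) := by
  have h3 := h.three_le
  have hw : Within (G.deleteEdges {s(a i, a (i + 1))}) (k - 1) (a (i + 1))
      (a (i + 1 + (k - 1 : ℕ))) := by
    refine Within.of_forall_adj _ _ _ fun j hj => ?_
    rw [SimpleGraph.deleteEdges_adj]
    refine ⟨h.adj _, fun he => ?_⟩
    have hi : a i ≠ a (i + 1 + j) := by
      have := h.ne i (t := j + 1) (by omega) (by omega)
      push_cast at this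
      rwa [add_comm (j : ℤ), ← add_assoc] at this
    rcases Sym2.eq_iff.1 (Set.mem_singleton_iff.1 he) with ⟨h', -⟩ | ⟨h', h''⟩
    · exact hi h'.symm
    · have := h.ne (i + 1) (t := j) (by
        rcases Nat.eq_zero_or_pos j with rfl | hj
        · exfalso
          have := h.ne i (t := 2) (by omega) (by omega)
          refine this ?_
          rw [← h'']
          congr 1
          push_cast
          ring
        · exact hj) (by omega)
      exact this h'.symm
  have he : a (i + 1 + (k - 1 : ℕ)) = a i := by
    rw [← h.periodic i]
    congr 1
    push_cast [Nat.cast_sub (by omega : 1 ≤ k)]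
    ring
  rw [he] at hw
  exact hw.reachable.symm

end IsIsometricCycle

/-- A walk of `G` either avoids the edge `x y`, or can be shortened to one that passes through this
edge exactly once. -/
theorem dist_deleteEdges_le_or {G : SimpleGraph V} {x y : V}
    (hH : (G.deleteEdges {s(x, y)}).Connected) {p q : V} (w : G.Walk p q) :
    (G.deleteEdges {s(x, y)}).dist p q ≤ w.length ∨
    (G.deleteEdges {s(x, y)}).dist p x + 1 + (G.deleteEdges {s(x, y)}).dist y q ≤ w.length ∨
    (G.deleteEdges {s(x, y)}).dist p y + 1 + (G.deleteEdges {s(x, y)}).dist x q ≤ w.length := by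
  set H := G.deleteEdges {s(x, y)} with hHdef
  induction w with
  | nil => left; simp
  | @cons p p' q hadj w ih =>
    rw [SimpleGraph.Walk.length_cons]
    by_cases he : s(p, p') = s(x, y)
    · rcases Sym2.eq_iff.1 he with ⟨rfl, rfl⟩ | ⟨rfl, rfl⟩ <;>
      · simp only [SimpleGraph.dist_self] at ih ⊢
        omega
    · have h1 : H.Adj p p' := by
        rw [hHdef, SimpleGraph.deleteEdges_adj]
        exact ⟨hadj, by simpa using he⟩
      have h1 := SimpleGraph.dist_eq_one_iff_adj.2 h1
      have hq := hH.dist_triangle (u := p) (v := p') (w := q)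
      have hx := hH.dist_triangle (u := p) (v := p') (w := x)
      have hy := hH.dist_triangle (u := p) (v := p') (w := y)
      omega

/-- A shortest cycle through a given edge is isometric. -/
theorem exists_isIsometricCycle {G : SimpleGraph V} (hG : G.Connected) {x y : V}
    (hxy : G.Adj x y) (hb : (G.deleteEdges {s(x, y)}).Reachable x y) :
    ∃ k a, IsIsometricCycle G k a ∧ a 0 = x ∧ a 1 = y := by
  have hH : (G.deleteEdges {s(x, y)}).Connected :=
    hG.connected_delete_edge_of_not_isBridge fun h => h hb
  set H := G.deleteEdges {s(x, y)} with hHdef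
  have hle : H ≤ G := SimpleGraph.deleteEdges_le _
  obtain ⟨p, hp⟩ := hH.exists_walk_length_eq_dist y x
  set k := p.length + 1 with hk
  have hnadj : ¬ H.Adj y x := by
    rw [hHdef, SimpleGraph.deleteEdges_adj, Sym2.eq_swap]
    simp
  have hk3 : 3 ≤ k := by
    have h0 := hH.one_lt_dist_of_ne_of_not_adj hxy.ne' hnadj
    omega
  -- distances along the geodesic `p` of `H`
  have hsub : ∀ r t : ℕ, r + t ≤ p.length → Within H t (p.getVert r) (p.getVert (r + t)) := by
    intro r t
    induction t with
    | zero => intro _; simpa using Within.refl H 0 _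
    | succ t ih =>
      intro hrt
      refine (ih (by omega)).trans (.of_adj ?_)
      exact p.adj_getVert_succ (by omega)
  have hpH : ∀ r t : ℕ, r + t ≤ p.length → H.dist (p.getVert r) (p.getVert (r + t)) = t := by
    intro r t hrt
    refine le_antisymm (hsub r t hrt).dist_le ?_
    have h1 := (hsub 0 r (by omega)).dist_le
    have h2 := (hsub (r + t) (p.length - (r + t)) (by omega)).dist_le
    rw [Nat.zero_add, p.getVert_zero] at h1
    rw [Nat.add_sub_cancel' hrt, p.getVert_length] at h2
    have h3 := hH.dist_triangle (u := y) (v := p.getVert r) (w := x)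
    have h4 := hH.dist_triangle (u := p.getVert r) (v := p.getVert (r + t)) (w := x)
    omega
  have hpG : ∀ r t : ℕ, r + t ≤ p.length →
      G.dist (p.getVert r) (p.getVert (r + t)) = min t (k - t) := by
    intro r t hrt
    have hy := hpH 0 r (by omega)
    have hx := hpH (r + t) (p.length - (r + t)) (by omega)
    have hy' := hpH 0 (r + t) (by omega)
    have hx' := hpH r (p.length - r) (by omega)
    rw [Nat.zero_add, p.getVert_zero] at hy hy'
    rw [Nat.add_sub_cancel' (by omega), p.getVert_length] at hx hx'
    refine le_antisymm (le_min ?_ ?_) ?_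
    · exact ((hsub r t hrt).mono_graph hle).dist_le
    · have h1 : Within G r (p.getVert r) y :=
        (Within.mono (.of_dist hH _ _) (by rw [SimpleGraph.dist_comm, hy])).mono_graph hle
      have h2 : Within G (p.length - (r + t)) x (p.getVert (r + t)) :=
        (Within.mono (.of_dist hH _ _) (by rw [SimpleGraph.dist_comm, hx])).mono_graph hle
      have := ((h1.trans (.of_adj hxy.symm)).trans h2).dist_le
      omega
    · obtain ⟨w, hw⟩ := hG.exists_walk_length_eq_dist (p.getVert r) (p.getVert (r + t))
      have h1 := dist_deleteEdges_le_or (x := x) (y := y) hH w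
      rw [← hHdef, hpH r t hrt, hx', hy', SimpleGraph.dist_comm (v := y), hy,
        SimpleGraph.dist_comm (u := x), hx] at h1
      omega
  -- `a i` is the vertex of `p` at position `i - 1` modulo `k`
  have hkpos : (0 : ℤ) < k := by omega
  refine ⟨k, fun i => p.getVert ((i - 1) % k).toNat, ⟨hk3, fun i => ?_, fun i t ht => ?_⟩, ?_, ?_⟩
  · simp only [add_sub_right_comm, Int.add_emod_right]
  · have hr0 := Int.emod_nonneg (i - 1) hkpos.ne'
    have hr1 := Int.emod_lt_of_pos (i - 1) hkpos
    obtain ⟨r, hr⟩ := Int.eq_ofNat_of_zero_le hr0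
    have hshift : (i + t - 1) % (k : ℤ) = ((r : ℤ) + t) % k := by
      rw [add_sub_right_comm, ← Int.emod_add_emod, hr]
    simp only [hshift, hr]
    rw [hr] at hr1
    rcases lt_or_ge (r + t) k with hlt | hge
    · rw [Int.emod_eq_of_lt (by omega) (by omega)]
      have : ((r : ℤ) + t).toNat = r + t := by omega
      rw [this, Int.toNat_natCast]
      exact hpG r t (by omega)
    · have : ((r : ℤ) + t) % k = ((r + t - k : ℕ) : ℤ) := by
        rw [Nat.cast_sub hge, ← Int.sub_emod_right, Int.emod_eq_of_lt (by omega) (by omega)]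
        push_cast
        ring
      rw [this, Int.toNat_natCast, Int.toNat_natCast]
      have h1 := hpG (r + t - k) (k - t) (by omega)
      rw [show r + t - k + (k - t) = r by omega, SimpleGraph.dist_comm] at h1
      rw [h1]
      omega
  · have : ((0 : ℤ) - 1) % k = ((k - 1 : ℕ) : ℤ) := by
      rw [← Int.add_emod_right, Int.emod_eq_of_lt (by omega) (by omega)]
      omega
    simp only [this, Int.toNat_natCast]
    rw [show k - 1 = p.length by omega, p.getVert_length]
  · simp

/-! ### Two agents exchanging edges -/

/-- Induction along the levels of a breadth first search from `c`. -/
theorem induction_dist {G : SimpleGraph V} (hG : G.Connected) {P : V → Prop} (c : V) (hc : P c)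
    (hstep : ∀ w w', G.Adj w' w → G.dist c w = G.dist c w' + 1 → P w' → P w) (w : V) : P w := by
  induction hn : G.dist c w generalizing w with
  | zero => rwa [← hG.dist_eq_zero_iff.1 hn]
  | succ n ih =>
    have hw : w ≠ c := by rintro rfl; simp at hn
    obtain ⟨w', hadj, hd⟩ := exists_adj_dist_add_one hG hw
    exact hstep w w' hadj hd (ih w' (by omega))

section

variable [DecidableEq V] {s : Profile V}

theorem deviation_anti {u : V} {D D' A : Finset V} (h : D' ⊆ D) :
    deviation s u D A ≤ deviation s u D' A := by
  have key : ∀ x, (Function.update s u ⟨((s u).1 \ D ∪ A).erase u, by simp⟩ x).1 ⊆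
      (Function.update s u ⟨((s u).1 \ D' ∪ A).erase u, by simp⟩ x).1 := by
    intro x
    by_cases hx : x = u
    · subst hx
      simp only [Function.update_self]
      exact Finset.erase_subset_erase _
        (Finset.union_subset_union_left (Finset.sdiff_subset_sdiff subset_rfl h))
    · simp only [Function.update_of_ne hx, subset_rfl]
  exact fun x y hxy => hxy.imp (fun h => key x h) (fun h => key y h)

/-- An agent `c` who buys an edge to `x` comes within `1 + d(x, w)` of every vertex `w`, provided
that this holds for the other endpoints of the edges that she deletes. -/
theorem within_deviation (hc : (network s).Connected) {c x : V} {D A : Finset V} (hx : x ∈ A)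
    (hxc : x ≠ c) (hD : ∀ y ∈ D, Within (deviation s c D A) (1 + (network s).dist x y) c y) (w : V) :
    Within (deviation s c D A) (1 + (network s).dist x w) c w := by
  refine induction_dist hc
    (P := fun w => Within (deviation s c D A) (1 + (network s).dist x w) c w) x ?_ ?_ w
  · exact (Within.of_adj (deviation_adj_of_mem hx hxc)).mono (by omega)
  · intro w w' hadj hd ih
    rcases deviation_adj_of_adj (u := c) (D := D) (A := A) hadj with
      h | ⟨rfl, hw⟩ | ⟨rfl, -⟩
    · exact (ih.trans (.of_adj h)).mono (by omega)
    · exact hD w hw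
    · exact .refl _ _ _

variable [Fintype V] {α : ℝ}

/-- The central estimate. Suppose that `v` owns the edges `v v₁` and `v v₂`, that `u` owns the edge
`u u₁`, that `d = d(v, u) ≥ 2`, and that neither `u u₁` is needed on the way from `v` to `u₁`, nor
`v v₁` on the way from `u` to `v₁`. For `v₂`, either `v v₂` is not needed on the way from `u` to
`v₂`, or `v` has a detour of length at most `2 d` to `v₂`. Then `α ≤ 4 n - 13`.

Compare three deviations: `u` replaces `u u₁` by `u v`; `v` replaces `v v₁` by `v u`; and `v`
replaces both `v v₁` and `v v₂` by the single edge `v u`. Up to the vertices `w` in a set `Y` that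
`u` reaches through `v v₂` only, each of them makes the distance vector of one of the two agents at
most `1` plus that of the other. The first two deviations together show that `Y` is small, since
both agents get closer to `Y`; the first and the third then bound the edge price. -/
theorem IsStable.le_of_exchange (hs : IsStable α s) (hα : 0 ≤ α) (hc : (network s).Connected)
    (hn : 4 ≤ Fintype.card V) {v u v₁ v₂ u₁ : V} (hv₁ : v₁ ∈ (s v).1) (hv₂ : v₂ ∈ (s v).1)
    (hne : v₁ ≠ v₂) (hu₁ : u₁ ∈ (s u).1) (hd : 2 ≤ (network s).dist v u)
    (hvu₁ : Within ((network s).deleteEdges {s(u, u₁)}) ((network s).dist v u₁) v u₁)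
    (huv₁ : Within ((network s).deleteEdges {s(v, v₁), s(v, v₂)}) ((network s).dist u v₁) u v₁)
    (huv₂ : Within ((network s).deleteEdges {s(v, v₁), s(v, v₂)}) ((network s).dist u v₂) u v₂ ∨
      Within ((network s).deleteEdges {s(v, v₁), s(v, v₂)}) (2 * (network s).dist v u) v v₂) :
    α ≤ 4 * (Fintype.card V : ℝ) - 13 := by
  classical
  set G := network s with hG
  have huv : u ≠ v := by rintro rfl; simp at hd
  set d := G.dist v u with hdef
  have hdu : G.dist u v = d := SimpleGraph.dist_comm
  -- `u` replaces `u u₁` by `u v`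
  set N := deviation s u {u₁} {v} with hN
  have hNw : ∀ w, Within N (1 + G.dist v w) u w := by
    refine within_deviation hc (by simp) huv.symm fun y hy => ?_
    rw [Finset.mem_singleton.1 hy]
    refine (Within.of_adj (deviation_adj_of_mem (by simp) huv.symm)).trans ?_
    exact hvu₁.mono_graph (deleteEdges_le_deviation (by simp))
  -- `v` replaces `v v₁` and `v v₂` by `v u`, or only `v v₁`
  set M := deviation s v {v₁, v₂} {u} with hM
  set M' := deviation s v {v₁} {u} with hM'
  have hMM' : M ≤ M' := deviation_anti (by simp)
  have hle : G.deleteEdges {s(v, v₁), s(v, v₂)} ≤ M := deleteEdges_le_deviation (by simp)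
  have hMu : Within M 1 v u := .of_adj (deviation_adj_of_mem (by simp) huv)
  have hM'v₂ : Within M' 1 v v₂ := by
    have hadj : G.Adj v v₂ := .inl hv₂
    refine .of_adj ?_
    rcases deviation_adj_of_adj (u := v) (D := {v₁}) (A := {u}) hadj with h | ⟨-, h⟩ | ⟨h, -⟩
    · exact h
    · exact absurd (Finset.mem_singleton.1 h).symm hne
    · exact absurd h hadj.ne'
  have hclaim : ∀ w, Within M (1 + G.dist u w) v w ∨
      (G.dist u w = d + G.dist v w ∧ Within M' (G.dist v w) v w ∧
        Within M (G.dist v w + (2 * d - 1)) v w) := by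
    refine induction_dist hc u (.inl (hMu.mono (by omega))) ?_
    intro w w' hadj hdist ih
    rcases deviation_adj_of_adj (u := v) (D := {v₁, v₂}) (A := {u}) hadj with
      h | ⟨rfl, hw⟩ | ⟨rfl, -⟩
    · rcases ih with ih | ⟨ih₁, ih₂, ih₃⟩
      · exact .inl ((ih.trans (.of_adj h)).mono (by omega))
      · have htri := hc.dist_triangle (u := u) (v := v) (w := w)
        have htri' := hc.dist_triangle (u := v) (v := w') (w := w)
        rw [SimpleGraph.dist_eq_one_iff_adj.2 hadj] at htri'
        rw [hdu] at htri
        refine .inr ⟨by omega, (ih₂.trans (.of_adj (hMM' h))).mono (by omega),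
          (ih₃.trans (.of_adj h)).mono (by omega)⟩
    · have hw : w = v₁ ∨ w = v₂ := by simpa using hw
      rcases hw with rfl | rfl
      · exact .inl (hMu.trans (huv₁.mono_graph hle))
      · rcases huv₂ with huv₂ | huv₂
        · exact .inl (hMu.trans (huv₂.mono_graph hle))
        · have h1 : G.dist w' w = 1 := SimpleGraph.dist_eq_one_iff_adj.2 hadj
          refine .inr ⟨by omega, by rwa [h1], (huv₂.mono_graph hle).mono (by omega)⟩
    · exact .inl (.refl _ _ _)
  set Y : Finset V := Finset.univ.filter fun w => ¬ Within M (1 + G.dist u w) v w with hY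
  have hvY : v ∉ Y := by simp [hY, Within.refl]
  have hYw : ∀ w ∈ Y, G.dist u w = d + G.dist v w ∧ Within M' (G.dist v w) v w ∧
      Within M (G.dist v w + (2 * d - 1)) v w := fun w hw =>
    (hclaim w).resolve_left (Finset.mem_filter.1 hw).2
  have hYw' : ∀ w ∉ Y, Within M (1 + G.dist u w) v w := fun w hw => by
    simpa [hY] using hw
  have h₁ := hs.le_of_within hα hc (u := u) (D := {u₁}) (A := {v}) (by simpa using hu₁)
    (f := fun w => if w = u then 0 else 1 + G.dist v w) fun w => by
      split_ifs with h
      · rw [h]; exact .refl _ _ _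
      · exact hNw w
  have h₂ := hs.le_of_within hα hc (u := v) (D := {v₁}) (A := {u}) (by simpa using hv₁)
    (f := fun w => if w = v then 0 else if w ∈ Y then G.dist v w else 1 + G.dist u w) fun w => by
      split_ifs with h h'
      · rw [h]; exact .refl _ _ _
      · exact (hYw w h').2.1
      · exact (hYw' w h').mono_graph hMM'
  have h₃ := hs.le_of_within hα hc (u := v) (D := {v₁, v₂}) (A := {u})
    (by simp [Finset.insert_subset_iff, hv₁, hv₂])
    (f := fun w => if w = v then 0 else if w ∈ Y then G.dist v w + (2 * d - 1)
      else 1 + G.dist u w) fun w => by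
      split_ifs with h h'
      · rw [h]; exact .refl _ _ _
      · exact (hYw w h').2.2
      · exact hYw' w h'
  have e₁ : ∑ w : V, ((if w = u then 0 else 1 + G.dist v w : ℕ) : ℝ) =
      (Fintype.card V : ℝ) + ∑ w : V, (G.dist v w : ℝ) - (1 + d) := by
    have : ∀ w : V, ((if w = u then 0 else 1 + G.dist v w : ℕ) : ℝ) =
        1 + (G.dist v w : ℝ) - if w = u then (1 + d : ℝ) else 0 := by
      intro w
      split_ifs with h
      · rw [h, ← hdef]; simp
      · push_cast; ring
    simp only [this, Finset.sum_sub_distrib, Finset.sum_add_distrib]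
    simp
  have e₂ : ∑ w : V, ((if w = v then 0 else if w ∈ Y then G.dist v w
      else 1 + G.dist u w : ℕ) : ℝ) =
      (Fintype.card V : ℝ) + ∑ w : V, (G.dist u w : ℝ) - (1 + d) - Y.card * (1 + d) := by
    have : ∀ w : V, ((if w = v then 0 else if w ∈ Y then G.dist v w
        else 1 + G.dist u w : ℕ) : ℝ) =
        1 + (G.dist u w : ℝ) - (if w = v then (1 + d : ℝ) else 0) -
          if w ∈ Y then (1 + d : ℝ) else 0 := by
      intro w
      by_cases h : w = v
      · subst h
        rw [if_pos rfl, if_pos rfl, if_neg hvY, hdu]; simp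
      · rw [if_neg h, if_neg h]
        split_ifs with h'
        · rw [(hYw w h').1]; push_cast; ring
        · push_cast; ring
    simp only [this, Finset.sum_sub_distrib, Finset.sum_add_distrib]
    simp [mul_add]
  have e₃ : ∑ w : V, ((if w = v then 0 else if w ∈ Y then G.dist v w + (2 * d - 1)
      else 1 + G.dist u w : ℕ) : ℝ) =
      (Fintype.card V : ℝ) + ∑ w : V, (G.dist u w : ℝ) - (1 + d) + Y.card * (d - 2) := by
    have : ∀ w : V, ((if w = v then 0 else if w ∈ Y then G.dist v w + (2 * d - 1)
        else 1 + G.dist u w : ℕ) : ℝ) =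
        1 + (G.dist u w : ℝ) - (if w = v then (1 + d : ℝ) else 0) +
          if w ∈ Y then (d - 2 : ℝ) else 0 := by
      intro w
      by_cases h : w = v
      · subst h
        rw [if_pos rfl, if_pos rfl, if_neg hvY, hdu]; simp
      · rw [if_neg h, if_neg h]
        split_ifs with h'
        · rw [(hYw w h').1]; push_cast [Nat.cast_sub (by omega : 1 ≤ 2 * d)]; ring
        · push_cast; ring
    simp only [this, Finset.sum_add_distrib, Finset.sum_sub_distrib]
    simp [mul_sub]
  rw [e₁] at h₁
  rw [e₂] at h₂
  rw [e₃] at h₃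
  rw [Finset.card_pair hne] at h₃
  simp only [Finset.card_singleton, Nat.cast_one, Nat.cast_ofNat, mul_one] at h₁ h₂ h₃
  have hd' : (2 : ℝ) ≤ d := by exact_mod_cast hd
  have hn' : (4 : ℝ) ≤ Fintype.card V := by exact_mod_cast hn
  have hY0 : (0 : ℝ) ≤ Y.card := by positivity
  rcases hd.eq_or_lt with h2 | h3
  · rw [← h2] at h₁ h₃
    push_cast at h₁ h₃
    linarith
  · have h3' : (3 : ℝ) ≤ d := by exact_mod_cast h3
    linarith

end

/-! ### Owners along isometric cycles -/

namespace IsIsometricCycle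

variable {G : SimpleGraph V} {k : ℕ} {a : ℤ → V}

theorem apply_add_mul (h : IsIsometricCycle G k a) (i m : ℤ) : a (i + m * k) = a i :=
  Function.Periodic.int_mul (f := a) (c := (k : ℤ)) h.periodic m i

theorem exists_add_eq (h : IsIsometricCycle G k a) (i j : ℤ) :
    ∃ t : ℕ, t < k ∧ ∃ m : ℤ, i + t = j + m * k := by
  have h3 := h.three_le
  have h0 := Int.emod_nonneg (j - i) (b := k) (by omega)
  have h1 := Int.emod_lt_of_pos (j - i) (b := k) (by omega)
  refine ⟨((j - i) % k).toNat, by omega, -((j - i) / k), ?_⟩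
  rw [Int.toNat_of_nonneg h0]
  linarith [Int.emod_add_mul_ediv (j - i) k]

theorem eq_of_add_eq (h : IsIsometricCycle G k a) {i : ℤ} {t t' : ℕ} (ht : t < k) (ht' : t' < k)
    (he : a (i + t) = a (i + t')) : t = t' := by
  by_contra hne
  rcases lt_or_gt_of_ne hne with hlt | hlt
  · have := h.ne (i + t) (t := t' - t) (by omega) (by omega)
    rw [Nat.cast_sub hlt.le] at this
    exact this (by rw [he]; congr 1; ring)
  · have := h.ne (i + t') (t := t - t') (by omega) (by omega)
    rw [Nat.cast_sub hlt.le] at this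
    exact this (by rw [← he]; congr 1; ring)

end IsIsometricCycle

section

variable [DecidableEq V] [Fintype V] {α : ℝ} {s : Profile V} {k : ℕ} {a : ℤ → V}

/-- Deleting an edge of an isometric cycle of length `k` increases no distance by more than
`k - 2`, and the distances to the vertices of the cycle itself by less. Hence cycles are long. -/
theorem IsStable.six_le_length (hs : IsStable α s) (hn : 4 ≤ Fintype.card V)
    (hα : 4 * (Fintype.card V : ℝ) - 13 < α) (h : IsIsometricCycle (network s) k a)
    (h01 : a 1 ∈ (s (a 0)).1) : 6 ≤ k := by
  have h3 := h.three_le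
  have hne : Nonempty V := ⟨a 0⟩
  have hc := hs.connected
  have hn' : (4 : ℝ) ≤ Fintype.card V := by exact_mod_cast hn
  set G := network s with hG
  set N := deviation s (a 0) {a 1} ∅ with hN
  have hinj : ∀ {t t' : ℕ}, t < k → t' < k → a t = a t' → t = t' := fun ht ht' he =>
    h.eq_of_add_eq (i := 0) ht ht' (by simpa using he)
  -- going around the cycle
  have hback : ∀ t : ℕ, 1 ≤ t → t ≤ k → Within N (k - t) (a 0) (a t) := by
    intro t ht1 htk
    have hw : Within N (k - t) (a t) (a (t + (k - t : ℕ))) := by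
      refine Within.of_forall_adj N t (k - t) fun j hj => ?_
      rcases deviation_adj_of_adj (u := a 0) (D := {a 1}) (A := ∅) (h.adj (t + j)) with
        h' | ⟨h', -⟩ | ⟨h', h''⟩
      · exact h'
      · have := hinj (t := t + j) (t' := 0) (by omega) (by omega) (by simpa using h')
        omega
      · have := hinj (t := t + j) (t' := 1) (by omega) (by omega) (by simpa using h'')
        have hk2 : (t : ℤ) + j + 1 = ((2 : ℕ) : ℤ) := by omega
        rw [hk2] at h'
        have := hinj (t := 2) (t' := 0) (by omega) (by omega) (by simpa using h')
        omega
    have he : a (t + (k - t : ℕ)) = a 0 := by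
      rw [← h.periodic 0]
      congr 1
      omega
    rw [he] at hw
    exact hw.symm
  have hall : ∀ w, Within N (G.dist (a 0) w + (k - 2)) (a 0) w := by
    refine induction_dist hc (a 0) (.refl _ _ _) fun w w' hadj hd ih => ?_
    rcases deviation_adj_of_adj (u := a 0) (D := {a 1}) (A := ∅) hadj with
      h' | ⟨rfl, h'⟩ | ⟨rfl, -⟩
    · exact (ih.trans (.of_adj h')).mono (by omega)
    · rw [Finset.mem_singleton.1 h']
      have := hback 1 le_rfl (by omega)
      rw [Nat.cast_one] at this
      refine this.mono ?_
      rw [SimpleGraph.dist_eq_one_iff_adj.2 (.inl h01 : G.Adj (a 0) (a 1))]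
      omega
    · exact .refl _ _ _
  -- what the vertex `a t` contributes less than `k - 2`
  set c : ℕ → ℕ := fun t => if t = 0 then k - 2 else min t (k - t) + t - 2 with hcdef
  have hsum : ∀ w, (∑ t ∈ Finset.range k, if w = a t then c t else 0) ≤
      G.dist (a 0) w + (k - 2) ∧ Within N (G.dist (a 0) w + (k - 2) -
        ∑ t ∈ Finset.range k, if w = a t then c t else 0) (a 0) w := by
    intro w
    by_cases hw : ∃ t < k, w = a t
    · obtain ⟨t, ht, rfl⟩ := hw
      rw [Finset.sum_eq_single_of_mem t (Finset.mem_range.2 ht) fun t' ht' hne =>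
        if_neg fun he => hne (hinj (Finset.mem_range.1 ht') ht he.symm), if_pos rfl]
      have hd := h.dist_eq 0 t ht.le
      rw [zero_add] at hd
      rw [hd, hcdef]
      rcases Nat.eq_zero_or_pos t with rfl | hpos
      · exact ⟨by simp, Within.refl _ _ _⟩
      · simp only [hpos.ne', if_false]
        exact ⟨by omega, (hback t hpos ht.le).mono (by omega)⟩
    · push Not at hw
      rw [Finset.sum_eq_zero fun t ht => if_neg (hw t (Finset.mem_range.1 ht))]
      exact ⟨Nat.zero_le _, hall w⟩
  have key := hs.le_of_within (by linarith) hc (u := a 0) (D := {a 1}) (A := ∅)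
    (by simpa using h01) fun w => (hsum w).2
  have hval : ∑ w : V, ((G.dist (a 0) w + (k - 2) -
      ∑ t ∈ Finset.range k, (if w = a t then c t else 0) : ℕ) : ℝ) =
      ∑ w : V, (G.dist (a 0) w : ℝ) + Fintype.card V * ((k - 2 : ℕ) : ℝ) -
        ∑ t ∈ Finset.range k, (c t : ℝ) := by
    have : ∀ w : V, ((G.dist (a 0) w + (k - 2) -
        ∑ t ∈ Finset.range k, (if w = a t then c t else 0) : ℕ) : ℝ) =
        G.dist (a 0) w + ((k - 2 : ℕ) : ℝ) -
          ∑ t ∈ Finset.range k, if w = a t then (c t : ℝ) else 0 := by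
      intro w
      rw [Nat.cast_sub (hsum w).1]
      push_cast
      rfl
    simp only [this, Finset.sum_sub_distrib, Finset.sum_add_distrib]
    rw [Finset.sum_comm]
    simp
  rw [hval] at key
  by_contra hk
  have hk : k < 6 := by omega
  simp only [Finset.card_singleton, Finset.card_empty, Nat.cast_one, Nat.cast_zero, mul_one,
    mul_zero] at key
  interval_cases k <;> norm_num [Finset.sum_range_succ, hcdef] at key <;> linarith

/-- The estimate `IsStable.le_of_exchange` for `v = a 0`, `v₁ = a 1` and an (almost) opposite
vertex `u = a d` on an isometric cycle. -/
theorem IsStable.le_of_isIsometricCycle (hs : IsStable α s) (hn : 4 ≤ Fintype.card V)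
    (hα : 0 ≤ α) (h : IsIsometricCycle (network s) k a) (h01 : a 1 ∈ (s (a 0)).1) {d : ℕ}
    (hd : 2 ≤ d) (hdk : 2 * d ≤ k) (hkd : k ≤ 2 * d + 2) (hu : a (d + 1) ∈ (s (a d)).1) {v₂ : V}
    (hv₂ : v₂ ∈ (s (a 0)).1) (hne : a 1 ≠ v₂)
    (huv₂ : Within ((network s).deleteEdges {s(a 0, a 1), s(a 0, v₂)})
        ((network s).dist (a d) v₂) (a d) v₂ ∨
      Within ((network s).deleteEdges {s(a 0, a 1), s(a 0, v₂)}) (2 * d) (a 0) v₂) :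
    α ≤ 4 * (Fintype.card V : ℝ) - 13 := by
  have : Nonempty V := ⟨a 0⟩
  have h0d : (network s).dist (a 0) (a d) = d := by
    have := h.dist_eq 0 d (by omega)
    rw [zero_add] at this
    omega
  refine hs.le_of_exchange hα hs.connected hn h01 hv₂ hne hu (by omega) ?_ ?_ (by rwa [h0d])
  · have hw := h.within_deleteEdges (E := {s(a d, a (d + 1))}) (c := a d) (by simp) (d + 1)
      (k - d - 1) fun j hj => by
        have := h.ne d (t := j + 1) (by omega) (by omega)
        push_cast at this
        rw [add_assoc, add_comm (1 : ℤ)]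
        exact this.symm
    have he : a (d + 1 + (k - d - 1 : ℕ)) = a 0 := by
      rw [← h.periodic 0]
      congr 1
      omega
    rw [he] at hw
    have hdist := h.dist_eq 0 (d + 1) (by omega)
    push_cast at hdist
    rw [zero_add] at hdist
    exact hw.symm.mono (by omega)
  · have hw := h.within_deleteEdges (E := {s(a 0, a 1), s(a 0, v₂)}) (c := a 0) (by simp) 1
      (d - 1) fun j hj => by
        have := h.ne 0 (t := j + 1) (by omega) (by omega)
        push_cast at this
        rw [zero_add, add_comm (j : ℤ)] at this
        exact this.symm
    have hdist := h.dist_eq 1 (d - 1) (by omega)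
    have he : (1 : ℤ) + (d - 1 : ℕ) = d := by omega
    rw [he] at hw hdist
    rw [SimpleGraph.dist_comm] at hdist
    exact hw.symm.mono (by omega)

theorem IsStable.not_owns_both (hs : IsStable α s) (hn : 4 ≤ Fintype.card V)
    (hα : 4 * (Fintype.card V : ℝ) - 13 < α) (h : IsIsometricCycle (network s) k a)
    (h01 : a 1 ∈ (s (a 0)).1) : a (-1) ∉ (s (a 0)).1 := by
  intro h0
  have hn' : (4 : ℝ) ≤ Fintype.card V := by exact_mod_cast hn
  have h6 := hs.six_le_length hn hα h h01
  have key : ∀ {a : ℤ → V} (_ : IsIsometricCycle (network s) k a) (_ : a 1 ∈ (s (a 0)).1)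
      (_ : a (-1) ∈ (s (a 0)).1) (d : ℕ) (_ : 2 ≤ d) (_ : 2 * d ≤ k) (_ : k ≤ 2 * d + 2),
      a (d + 1) ∉ (s (a d)).1 := by
    intro a h h01 h0 d hd hdk hkd hu
    refine absurd (hs.le_of_isIsometricCycle hn (by linarith) h h01 hd hdk hkd hu h0 ?_ (.inl ?_))
      hα.not_ge
    · have := h.ne (-1) (t := 2) (by omega) (by omega)
      exact this.symm
    · have hw := h.within_deleteEdges (E := {s(a 0, a 1), s(a 0, a (-1))}) (c := a 0) (by simp) d
        (k - 1 - d) fun j hj => by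
          have := h.ne 0 (t := d + j) (by omega) (by omega)
          push_cast at this
          rw [zero_add] at this
          exact this.symm
      have hdist := h.dist_eq d (k - 1 - d) (by omega)
      have he : a (d + (k - 1 - d : ℕ)) = a (-1) := by
        rw [← h.periodic (-1)]
        congr 1
        omega
      rw [he] at hw hdist
      exact hw.mono (by omega)
  -- one of the two endpoints of the edge opposite to `a 0` owns it
  set d := (k - 1) / 2 with hd
  rcases (h.adj d : _ ∨ _) with hu | hu
  · exact key h h01 h0 d (by omega) (by omega) (by omega) hu
  · refine key h.reflect h0 (by simpa using h01) (k - d - 1) (by omega) (by omega) (by omega) ?_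
    have e1 : a (-((k - d - 1 : ℕ) + 1)) = a d := by
      rw [← h.periodic]
      congr 1
      omega
    have e2 : a (-((k - d - 1 : ℕ) : ℤ)) = a (d + 1) := by
      rw [← h.periodic]
      congr 1
      omega
    rwa [e1, e2]

/-- Isometric cycles are directed: every agent on the cycle owns the edge to her successor. -/
theorem IsStable.owns_succ (hs : IsStable α s) (hn : 4 ≤ Fintype.card V)
    (hα : 4 * (Fintype.card V : ℝ) - 13 < α) (h : IsIsometricCycle (network s) k a)
    (h01 : a 1 ∈ (s (a 0)).1) (i : ℤ) : a (i + 1) ∈ (s (a i)).1 := by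
  -- ownership towards the predecessor would propagate until it reaches `a 0`
  have key : ∀ j : ℤ, a (j - 1) ∈ (s (a j)).1 → a j ∈ (s (a (j + 1))).1 := by
    intro j hj
    rcases (h.adj j : _ ∨ _) with h' | h'
    · refine absurd ?_ (hs.not_owns_both hn hα (h.rotate j) ?_) <;> rwa [add_zero]
    · exact h'
  by_contra hi
  have hi' := (h.adj i : _ ∨ _).resolve_left hi
  have hprop : ∀ t : ℕ, a (i + t) ∈ (s (a (i + t + 1))).1 := by
    intro t
    induction t with
    | zero => rwa [Nat.cast_zero, add_zero]
    | succ t ih =>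
      have := key (i + t + 1) (by simpa only [add_sub_cancel_right] using ih)
      rwa [Nat.cast_succ, ← add_assoc]
  obtain ⟨t, -, m, ht⟩ := h.exists_add_eq i (-1)
  have := hprop t
  rw [ht, h.apply_add_mul, show -1 + m * (k : ℤ) + 1 = 0 + m * k by ring, h.apply_add_mul] at this
  exact hs.not_owns_both hn hα h h01 this

end

/-! ### Agents owning several non-bridge edges -/

section

variable [DecidableEq V] [Fintype V] {α : ℝ} {s : Profile V} {k : ℕ} {a : ℤ → V}

/-- No agent owns two non-bridge edges: on the longer of two shortest cycles through these edges,
the opposite agent `u` satisfies the hypotheses of `IsStable.le_of_exchange`, where the detour is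
provided by the shorter cycle. -/
theorem IsStable.eq_of_owns (hs : IsStable α s) (hn : 4 ≤ Fintype.card V)
    (hα : 4 * (Fintype.card V : ℝ) - 13 < α) {v v₁ v₂ : V} (h₁ : v₁ ∈ (s v).1)
    (h₂ : v₂ ∈ (s v).1) (hb₁ : ((network s).deleteEdges {s(v, v₁)}).Reachable v v₁)
    (hb₂ : ((network s).deleteEdges {s(v, v₂)}).Reachable v v₂) : v₁ = v₂ := by
  by_contra hne
  have hn' : (4 : ℝ) ≤ Fintype.card V := by exact_mod_cast hn
  have : Nonempty V := ⟨v⟩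
  obtain ⟨k, a, ha, rfl, rfl⟩ := exists_isIsometricCycle hs.connected (.inl h₁) hb₁
  obtain ⟨l, b, hb, hb0, rfl⟩ := exists_isIsometricCycle hs.connected (.inl h₂) hb₂
  wlog hlk : l ≤ k generalizing k a l b
  · exact this l b hb (by rwa [hb0]) (by rwa [hb0]) k a ha hb0.symm (by rwa [hb0])
      (by rwa [hb0]) (Ne.symm hne) (by omega)
  have h2' : b 1 ∈ (s (b 0)).1 := by rwa [hb0]
  have hk6 := hs.six_le_length hn hα ha h₁
  have hl6 := hs.six_le_length hn hα hb h2'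
  refine absurd (hs.le_of_isIsometricCycle hn (by linarith) ha h₁ (d := k / 2) (by omega)
    (by omega) (by omega) (hs.owns_succ hn hα ha h₁ _) h₂ hne (.inr ?_)) hα.not_ge
  have hw := hb.within_deleteEdges (E := {s(a 0, a 1), s(a 0, b 1)}) (c := b 0)
    (by simp [hb0]) 1 (l - 2) fun j hj => by
      have := hb.ne 0 (t := 1 + j) (by omega) (by omega)
      push_cast at this
      rw [zero_add] at this
      exact this.symm
  have he : b (1 + (l - 2 : ℕ)) = b (-1) := by
    rw [← hb.periodic (-1)]
    congr 1
    omega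
  rw [he] at hw
  -- the last edge of the shorter cycle is not owned by `v`, thus it is not one of her two edges
  have hlast : ((network s).deleteEdges {s(a 0, a 1), s(a 0, b 1)}).Adj (b (-1)) (a 0) := by
    have hadj := hb.adj (-1)
    rw [neg_add_cancel, hb0] at hadj
    rw [SimpleGraph.deleteEdges_adj, Sym2.eq_swap (a := b (-1))]
    refine ⟨hadj, ?_⟩
    have hown := hs.not_owns_both hn hα hb h2'
    rw [hb0] at hown
    simp only [Set.mem_insert_iff, Set.mem_singleton_iff, Sym2.congr_right]
    rintro (h | h)
    · rw [h] at hown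
      exact hown h₁
    · rw [h] at hown
      exact hown h₂
  exact (hw.trans (.of_adj hlast)).symm.mono (by omega)

end

/-! ### Cycles attached to the rest of the network by bridges -/

/-- A vertex `a j` of the cycle is a gate of `w` if `w` can be reached from all vertices of the
cycle by a shortest path through `a j`. -/
def IsGate (G : SimpleGraph V) (a : ℤ → V) (j : ℤ) (w : V) : Prop :=
  ∀ i, G.dist (a i) w = G.dist (a i) (a j) + G.dist (a j) w

theorem IsGate.eq {G : SimpleGraph V} (hG : G.Connected) {a : ℤ → V} {i j : ℤ} {w : V}
    (hi : IsGate G a i w) (hj : IsGate G a j w) : a i = a j := by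
  have h1 := hi j
  have h2 := hj i
  exact hG.dist_eq_zero_iff.1 (by omega)

theorem IsIsometricCycle.exists_isGate {G : SimpleGraph V} {k : ℕ} {a : ℤ → V} (hG : G.Connected)
    (h : IsIsometricCycle G k a)
    (hbr : ∀ i p, p ∉ Set.range a → G.Adj (a i) p → G.IsBridge s(a i, p)) (w : V) :
    ∃ j, IsGate G a j w := by
  classical
  by_cases hw : w ∈ Set.range a
  · obtain ⟨j, rfl⟩ := hw
    exact ⟨j, fun i => by simp⟩
  -- the edge through which a walk from `w` enters the cycle for the first time
  have hentry : ∀ {x y : V} (q : G.Walk x y), y = a 0 → x ∉ Set.range a →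
      ∃ j p, p ∉ Set.range a ∧ G.Adj (a j) p ∧ (G.deleteEdges {s(a j, p)}).Reachable x p := by
    intro x y q
    induction q with
    | nil => rintro rfl hx; exact absurd ⟨0, rfl⟩ hx
    | @cons x x' y hadj q ih =>
      intro hy hx
      by_cases hx' : x' ∈ Set.range a
      · obtain ⟨j, rfl⟩ := hx'
        exact ⟨j, x, hx, hadj.symm, .refl _⟩
      · obtain ⟨j, p, hp, hjp, hr⟩ := ih hy hx'
        refine ⟨j, p, hp, hjp, .trans (SimpleGraph.Adj.reachable ?_) hr⟩
        rw [SimpleGraph.deleteEdges_adj]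
        refine ⟨hadj, fun he => ?_⟩
        rcases Sym2.eq_iff.1 (Set.mem_singleton_iff.1 he) with ⟨h1, -⟩ | ⟨-, h1⟩
        · exact hx ⟨j, h1.symm⟩
        · exact hx' ⟨j, h1.symm⟩
  obtain ⟨q⟩ := hG w (a 0)
  obtain ⟨j, p, hp, hjp, hr⟩ := hentry q rfl hw
  refine ⟨j, fun i => le_antisymm hG.dist_triangle ?_⟩
  obtain ⟨q, hq⟩ := hG.exists_walk_length_eq_dist (a i) w
  by_cases hj : a j ∈ q.support
  · rw [← hq, ← congrArg SimpleGraph.Walk.length (q.take_spec hj), SimpleGraph.Walk.length_append]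
    exact add_le_add (SimpleGraph.dist_le _) (SimpleGraph.dist_le _)
  · exfalso
    refine SimpleGraph.isBridge_iff.1 (hbr j p hp hjp) ?_
    have h1 : (G.deleteEdges {s(a j, p)}).Reachable (a i) w :=
      ⟨q.toDeleteEdges {s(a j, p)} fun e he hep => hj (by
        rw [Set.mem_singleton_iff.1 hep] at he
        exact q.fst_mem_support_of_mem_edges he)⟩
    obtain ⟨t, -, m, ht⟩ := h.exists_add_eq j i
    have h2 : Within (G.deleteEdges {s(a j, p)}) t (a j) (a (j + t)) := by
      refine Within.of_forall_adj _ _ _ fun r _ => ?_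
      rw [SimpleGraph.deleteEdges_adj]
      refine ⟨h.adj _, fun he => ?_⟩
      rcases Sym2.eq_iff.1 (Set.mem_singleton_iff.1 he) with ⟨-, h1⟩ | ⟨h1, -⟩
      · exact hp ⟨_, h1⟩
      · exact hp ⟨_, h1⟩
    rw [ht, h.apply_add_mul] at h2
    exact h2.reachable.trans (h1.trans hr)

section

variable [DecidableEq V] [Fintype V] {α : ℝ} {s : Profile V} {k : ℕ} {a : ℤ → V}

theorem IsStable.isBridge_of_notMem (hs : IsStable α s) (hn : 4 ≤ Fintype.card V)
    (hα : 4 * (Fintype.card V : ℝ) - 13 < α) (h : IsIsometricCycle (network s) k a)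
    (hown : ∀ i, a (i + 1) ∈ (s (a i)).1) {i : ℤ} {p : V} (hp : p ∉ Set.range a)
    (hadj : (network s).Adj (a i) p) : (network s).IsBridge s(a i, p) := by
  have : Nonempty V := ⟨p⟩
  rw [SimpleGraph.isBridge_iff]
  intro hb
  rcases hadj with hip | hpi
  · exact hp ⟨_, hs.eq_of_owns hn hα (hown i) hip (h.reachable_deleteEdges i) hb⟩
  · -- a directed cycle through the edge from `p` to `a i` can never leave the cycle `a` again
    rw [Sym2.eq_swap] at hb
    obtain ⟨l, b, hb, hb0, hb1⟩ := exists_isIsometricCycle hs.connected (.inl hpi) hb.symm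
    have hownb := hs.owns_succ hn hα hb (by rwa [hb0, hb1])
    have hstay : ∀ t : ℕ, b (1 + t) = a (i + t) := by
      intro t
      induction t with
      | zero => simpa using hb1
      | succ t ih =>
        have h1 := hownb (1 + t)
        have h2 := hb.reachable_deleteEdges (1 + t)
        rw [ih] at h1 h2
        have := hs.eq_of_owns hn hα h1 (hown (i + t)) h2 (h.reachable_deleteEdges _)
        push_cast
        rwa [← add_assoc, ← add_assoc]
    have h3 := hb.three_le
    refine hp ⟨i + (l - 1 : ℕ), ?_⟩
    rw [← hstay, ← hb0, ← hb.periodic 0]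
    congr 1
    omega

open Classical in
/-- If every vertex has a gate, then `a i` has the option to replace her edge to `a (i + 1)` by an
edge to `a (i + 2)`. Only the vertices with gate `a (i + 1)` get farther away (by one), while those
with gate `a (i + 2)` or `a (i + 3)` get closer. -/
theorem IsStable.card_isGate_lt (hs : IsStable α s) (hα : 0 ≤ α)
    (h : IsIsometricCycle (network s) k a) (hk : 6 ≤ k) {i : ℤ} (hi : a (i + 1) ∈ (s (a i)).1)
    (hgate : ∀ w, ∃ j, IsGate (network s) a j w) :
    (Finset.univ.filter (IsGate (network s) a (i + 2))).card <
      (Finset.univ.filter (IsGate (network s) a (i + 1))).card := by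
  have : Nonempty V := ⟨a 0⟩
  have hc := hs.connected
  set G := network s with hG
  set N := deviation s (a i) {a (i + 1)} {a (i + 2)} with hN
  have hinj : ∀ {t t' : ℕ}, t < k → t' < k → a (i + t) = a (i + t') → t = t' := fun ht ht' he =>
    h.eq_of_add_eq ht ht' he
  -- the gate of `w` is `a (i + t w)`
  have hgate' : ∀ w, ∃ t : ℕ, t < k ∧ IsGate G a (i + t) w := by
    intro w
    obtain ⟨j, hj⟩ := hgate w
    obtain ⟨t, ht, m, htm⟩ := h.exists_add_eq i j
    refine ⟨t, ht, fun l => ?_⟩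
    rw [htm, h.apply_add_mul]
    exact hj l
  choose t htk ht using hgate'
  have htiff : ∀ (w : V) (r : ℕ), r < k → (t w = r ↔ IsGate G a (i + r) w) := by
    intro w r hr
    refine ⟨fun h => h ▸ ht w, fun h' => hinj (htk w) hr ((ht w).eq hc h')⟩
  have hadjN : ∀ r : ℕ, 1 ≤ r → r + 1 < k → N.Adj (a (i + r)) (a (i + r + 1)) := by
    intro r hr hrk
    rcases deviation_adj_of_adj (u := a i) (D := {a (i + 1)}) (A := {a (i + 2)})
      (h.adj (i + r)) with h' | ⟨h', -⟩ | ⟨h', -⟩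
    · exact h'
    · have := hinj (t := r) (t' := 0) (by omega) (by omega) (by simpa using h')
      omega
    · have := hinj (t := r + 1) (t' := 0) (by omega) (by omega) (by
        push_cast; simpa [← add_assoc] using h')
      omega
  have hlast : N.Adj (a (i + (k - 1 : ℕ))) (a i) := by
    have he : a (i + (k - 1 : ℕ) + 1) = a i := by
      rw [← h.periodic i]
      congr 1
      omega
    have hadj := h.adj (i + (k - 1 : ℕ))
    rw [he] at hadj
    rcases deviation_adj_of_adj (u := a i) (D := {a (i + 1)}) (A := {a (i + 2)}) hadj with
      h' | ⟨h', -⟩ | ⟨-, h'⟩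
    · exact h'
    · have := hinj (t := k - 1) (t' := 0) (by omega) (by omega) (by simpa using h')
      omega
    · have := hinj (t := k - 1) (t' := 1) (by omega) (by omega) (by simpa using h')
      omega
  have hwalk : ∀ r l : ℕ, 1 ≤ r → r + l < k → Within N l (a (i + r)) (a (i + r + l)) := by
    intro r l hr hrl
    refine Within.of_forall_adj N _ _ fun j hj => ?_
    have := hadjN (r + j) (by omega) (by omega)
    push_cast at this
    rwa [← add_assoc] at this
  have hne2 : a (i + 2) ≠ a i := by
    intro he
    have := hinj (t := 2) (t' := 0) (by omega) (by omega) (by simpa using he)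
    omega
  have h2 : Within N 1 (a i) (a (i + 2)) := .of_adj (deviation_adj_of_mem (by simp) hne2)
  set r : ℕ → ℕ := fun t => if t = 0 then 0 else if t = 1 then 2 else min (t - 1) (k - t) with hr
  have hcyc : ∀ t : ℕ, t < k → Within N (r t) (a i) (a (i + t)) := by
    intro t htk
    rcases Nat.eq_zero_or_pos t with rfl | hpos
    · simpa using Within.refl _ _ _
    rcases Nat.eq_or_lt_of_le (Nat.succ_le_of_lt hpos) with rfl | h1
    · simpa [hr] using
        (show Within N 2 (a i) (a (i + 1)) from by
          have h12 := hwalk 1 1 le_rfl (by omega)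
          push_cast at h12
          rw [add_assoc, one_add_one_eq_two] at h12
          exact h2.trans h12.symm)
    · have hfor : Within N (t - 1) (a i) (a (i + t)) := by
        have h12 := hwalk 2 (t - 2) (by omega) (by omega)
        have he : i + (2 : ℕ) + (t - 2 : ℕ) = i + t := by omega
        rw [he] at h12
        exact (h2.trans h12).mono (by omega)
      have hback : Within N (k - t) (a i) (a (i + t)) := by
        have h12 := hwalk t (k - 1 - t) (by omega) (by omega)
        have he : i + t + (k - 1 - t : ℕ) = i + (k - 1 : ℕ) := by omega
        rw [he] at h12
        exact (h12.trans (.of_adj hlast)).symm.mono (by omega)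
      have hrt : r t = min (t - 1) (k - t) := by
        simp only [hr]
        rw [if_neg (by omega), if_neg (by omega)]
      rw [hrt]
      rcases min_choice (t - 1) (k - t) with h' | h' <;> rw [h'] <;> assumption
  -- a shortest path from the gate to `w` does not use the deleted edge
  have hout : ∀ (j : ℤ) (w : V), IsGate G a j w → Within N (G.dist (a j) w) (a j) w := by
    intro j
    refine induction_dist hc (P := fun w => IsGate G a j w → Within N (G.dist (a j) w) (a j) w)
      (a j) (fun _ => .refl _ _ _) fun w w' hadj hd ih hw => ?_
    have hw' : IsGate G a j w' := by
      intro l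
      have h1 := hw l
      have h2 : G.dist (a l) w ≤ G.dist (a l) w' + G.dist w' w := hc.dist_triangle
      have h3 : G.dist (a l) w' ≤ G.dist (a l) (a j) + G.dist (a j) w' := hc.dist_triangle
      rw [SimpleGraph.dist_eq_one_iff_adj.2 hadj] at h2
      omega
    have hself : ∀ l : ℤ, IsGate G a j (a l) → a l = a j := fun l hl =>
      IsGate.eq hc (fun l' => by simp) hl
    rcases deviation_adj_of_adj (u := a i) (D := {a (i + 1)}) (A := {a (i + 2)}) hadj with
      h' | ⟨h', h''⟩ | ⟨h', h''⟩
    · exact ((ih hw').trans (.of_adj h')).mono (by omega)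
    all_goals
      rw [Finset.mem_singleton] at h''
      subst h' h''
      have := (hself _ hw).trans (hself _ hw').symm
      exact absurd this (by first | exact (h.adj i).ne | exact (h.adj i).ne')
  have hdist : ∀ w, G.dist (a i) w = min (t w) (k - t w) + G.dist (a (i + t w)) w := by
    intro w
    rw [ht w i, h.dist_eq i (t w) (htk w).le]
  have key := hs.le_of_within hα hc (u := a i) (D := {a (i + 1)}) (A := {a (i + 2)})
    (by simpa using hi) (f := fun w => r (t w) + G.dist (a (i + t w)) w)
    fun w => (hcyc (t w) (htk w)).trans (hout _ w (ht w))
  have hpoint : ∀ w : V, ((r (t w) + G.dist (a (i + t w)) w : ℕ) : ℝ) ≤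
      G.dist (a i) w + (if t w = 1 then 1 else 0) - (if t w = 2 then 1 else 0) -
        (if t w = 3 then 1 else 0) := by
    intro w
    have hk' := htk w
    have hw := hdist w
    have : r (t w) + G.dist (a (i + t w)) w + (if t w = 2 then 1 else 0) +
        (if t w = 3 then 1 else 0) ≤ G.dist (a i) w + (if t w = 1 then 1 else 0) := by
      simp only [hr]
      split_ifs <;> omega
    have h' : ((r (t w) + G.dist (a (i + t w)) w : ℕ) : ℝ) + (if t w = 2 then 1 else 0) +
        (if t w = 3 then 1 else 0) ≤ G.dist (a i) w + (if t w = 1 then 1 else 0) := by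
      exact_mod_cast this
    linarith
  have hsum := key.trans (add_le_add_right (Finset.sum_le_sum fun w _ => hpoint w) _)
  simp only [Finset.sum_sub_distrib, Finset.sum_add_distrib, Finset.card_singleton,
    Finset.sum_boole, ← hG] at hsum
  have hcard : ∀ r : ℕ, r < k → Finset.univ.filter (fun w => t w = r) =
      Finset.univ.filter (IsGate G a (i + r)) := by
    intro r hr
    ext w
    simp [htiff w r hr]
  have h1 := hcard 1 (by omega)
  have h2 := hcard 2 (by omega)
  have h3 : 0 < (Finset.univ.filter (fun w => t w = 3)).card := by
    refine Finset.card_pos.2 ⟨a (i + (3 : ℕ)), ?_⟩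
    rw [Finset.mem_filter]
    exact ⟨Finset.mem_univ _, (htiff _ 3 (by omega)).2 fun l => by simp⟩
  push_cast at h1 h2
  rw [← h1, ← h2]
  have h3' : (1 : ℝ) ≤ (Finset.univ.filter (fun w => t w = 3)).card := by exact_mod_cast h3
  have : ((Finset.univ.filter (fun w => t w = 2)).card : ℝ) <
      (Finset.univ.filter (fun w => t w = 1)).card := by linarith
  exact_mod_cast this

end

end NetworkCreation

theorem theorem1 {V : Type*} [Fintype V] [DecidableEq V] (hn : 4 ≤ Fintype.card V)
    (α : ℝ) (hα : 4 * (Fintype.card V : ℝ) - 13 < α)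
    (s : NetworkCreation.Profile V) (hs : NetworkCreation.IsStable α s) :
    (NetworkCreation.network s).IsTree := by
  classical
  have hne : Nonempty V := Fintype.card_pos_iff.1 (by omega)
  have hn' : (4 : ℝ) ≤ Fintype.card V := by exact_mod_cast hn
  have hc := hs.connected
  refine ⟨hc, SimpleGraph.isAcyclic_iff_forall_adj_isBridge.2 ?_⟩
  by_contra hcyc
  push Not at hcyc
  obtain ⟨x, y, hxy, hb⟩ := hcyc
  rw [SimpleGraph.isBridge_iff, not_not] at hb
  obtain ⟨k, a, ha, h01⟩ : ∃ k a, IsIsometricCycle (network s) k a ∧ a 1 ∈ (s (a 0)).1 := by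
    rcases hxy with h | h
    · obtain ⟨k, a, ha, rfl, rfl⟩ := exists_isIsometricCycle hc (.inl h) hb
      exact ⟨k, a, ha, h⟩
    · rw [Sym2.eq_swap] at hb
      obtain ⟨k, a, ha, rfl, rfl⟩ := exists_isIsometricCycle hc (.inl h) hb.symm
      exact ⟨k, a, ha, h⟩
  have hown := hs.owns_succ hn hα ha h01
  have hgate := ha.exists_isGate hc fun i p hp hadj =>
    hs.isBridge_of_notMem hn hα ha hown hp hadj
  have hlt := fun i => hs.card_isGate_lt (by linarith) ha (hs.six_le_length hn hα ha h01)
    (hown i) hgate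
  -- the number of vertices with gate `a i` would decrease all the way around the cycle
  have hdec : ∀ m : ℕ, (Finset.univ.filter (IsGate (network s) a (1 + m))).card + m ≤
      (Finset.univ.filter (IsGate (network s) a 1)).card := by
    intro m
    induction m with
    | zero => simp
    | succ m ih =>
      have := hlt m
      rw [add_comm (m : ℤ) 1, show (m : ℤ) + 2 = 1 + (m + 1 : ℕ) by push_cast; ring] at this
      omega
  have hper : IsGate (network s) a (1 + k) = IsGate (network s) a 1 := by
    funext w
    simp only [IsGate, ha.periodic]
  have h := hdec k
  rw [Finset.filter_congr fun w _ => iff_of_eq (congrFun hper w)] at h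
  have := ha.three_le
  omega
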